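/- Let $(f_n)_{n\ge 1}$ be a sequence of complex polynomials such that $\lim_{n\to\infty} f_n^{(k)}(0)$ exists for every integer $k\ge 0$ and $\lim_{n\to\infty} f_n(0)\neq 0$. Suppose that for every $n$ all the zeros of $f_n$ lie in the closed right half plane $\{z\in\mathbb{C}:\operatorname{Re} z\ge 0\}$ (this condition is regarded as satisfied if $f_n$ is the zero polynomial). Then $(f_n)$ converges, uniformly on compact subsets of $\mathbb{C}$, to an entire function $f$ of the form $$f(z)=f(0)\,e^{\alpha z^2-\beta z}\prod_j\left(1-\frac{z}{a_j}\right)e^{z/a_j}\qquad(z\in\mathbb{C}),$$ where $\alpha,\beta$ are complex constants and $(a_j)$ is a finite (possibly empty) or countably infinite family of nonzero complex numbers with $\operatorname{Re} a_j\ge 0$ for all $j$ and $\sum_j |a_j|^{-2}<\infty$. Furthermore, $\sum_j \operatorname{Re}(1/a_j)$ converges with $$\sum_j \operatorname{Re}(1/a_j)\le \operatorname{Re}\beta,$$ and $\alpha$ is real with $\alpha\ge 0$. -/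

import Mathlib

open Filter Topology

namespace PolySeq

/-- A sequence of polynomials converges weakly if, for every `k`, the sequence of the `k`-th
derivatives at `0` converges. -/
def WeaklyConvergent (f : ℕ → Polynomial ℂ) : Prop :=
  ∀ k : ℕ, ∃ c : ℂ, Tendsto (fun n => ((Polynomial.derivative^[k]) (f n)).eval 0) atTop (𝓝 c)

/-- A sequence of functions on `ℂ` converges strongly to `g` if it converges to `g` uniformly on
every compact subset of `ℂ`. -/
def StronglyConvergesTo (F : ℕ → ℂ → ℂ) (g : ℂ → ℂ) : Prop :=
  ∀ K : Set ℂ, IsCompact K → TendstoUniformlyOn F g atTop K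

/-- The zero set of a polynomial; by convention it is empty for the zero polynomial. -/
def zeroSet (p : Polynomial ℂ) : Set ℂ := {z | p ≠ 0 ∧ p.eval z = 0}

/-- The closed right half plane. -/
def rightHalfPlane : Set ℂ := {z | 0 ≤ z.re}

end PolySeq

/-!
Write `f_n(z) = f_n(0) ∏ⱼ (1 - x_{n,j} z)`, the `x_{n,j}` being the reciprocals of the zeros. The
first three coefficients of `f_n` determine `∑ⱼ x_{n,j}` and `∑ⱼ x_{n,j}²`, so both power sums
converge. Since `Re x_{n,j} ≥ 0` and `|w|² = 2 (Re w) w - w²`, this bounds `∑ⱼ |x_{n,j}|²`, and with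
it `f_n` on discs; the Taylor series then converge uniformly there.

Order each row by decreasing modulus, so that `|x_{n,j}| ≤ √(C / (j + 1))`, and take limits `yⱼ` of
the columns along an ultrafilter. The bound is cube summable, so the products of genus `2` pass to
the limit. Returning to genus `1` costs a factor `exp (α z²)`, where `2α` is the difference between
`∑ⱼ yⱼ²` and the limit of `∑ⱼ x_{n,j}²`; by the identity above it is the mass lost by
`∑ⱼ |x_{n,j}|²`, hence real and nonnegative.
-/

namespace PolySeq

section LimitsOfEntireFunctions

open scoped Nat

variable {τ E : Type*} {l : Filter τ} [NormedAddCommGroup E] [NormedSpace ℂ E]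
  {F : τ → ℂ → E}

theorem norm_taylorTerm_le {z : ℂ} {w : E} {R D : ℝ} (k : ℕ) (hR : 0 < R) (hz : ‖z‖ ≤ R)
    (hw : ‖w‖ ≤ k ! * D / (2 * R) ^ k) : ‖(k ! : ℂ)⁻¹ • z ^ k • w‖ ≤ D * (1 / 2) ^ k := by
  rw [norm_smul, norm_smul, norm_inv, norm_pow, Complex.norm_natCast]
  calc (k ! : ℝ)⁻¹ * (‖z‖ ^ k * ‖w‖) ≤ (k ! : ℝ)⁻¹ * (R ^ k * (k ! * D / (2 * R) ^ k)) := by gcongr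
    _ = D * (1 / 2) ^ k := by simp only [mul_pow, one_div, inv_pow]; field_simp

variable [CompleteSpace E]

theorem tendstoUniformlyOn_closedBall_of_tendsto_iteratedDeriv [l.NeBot] {c : ℕ → E} {R B : ℝ}
    (hR : 0 < R) (hF : ∀ n, Differentiable ℂ (F n))
    (hc : ∀ k, Tendsto (fun n => iteratedDeriv k (F n) 0) l (𝓝 (c k)))
    (hB : ∀ᶠ n in l, ∀ z, ‖z‖ ≤ 2 * R → ‖F n z‖ ≤ B) :
    TendstoUniformlyOn F (fun z => ∑' k : ℕ, (k ! : ℂ)⁻¹ • z ^ k • c k) l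
      (Metric.closedBall 0 R) := by
  have cauchy : ∀ᶠ n in l, ∀ k, ‖iteratedDeriv k (F n) 0‖ ≤ k ! * B / (2 * R) ^ k :=
    hB.mono fun n h k => Complex.norm_iteratedDeriv_le_of_forall_mem_sphere_norm_le k
      (by positivity) (hF n).diffContOnCl fun z hz => h z (mem_sphere_zero_iff_norm.1 hz).le
  have cauchy_lim : ∀ k, ‖c k‖ ≤ k ! * B / (2 * R) ^ k := fun k =>
    le_of_tendsto (hc k).norm (cauchy.mono fun n h => h k)
  have summable_lim : ∀ {z : ℂ}, ‖z‖ ≤ R → Summable fun k : ℕ => (k ! : ℂ)⁻¹ • z ^ k • c k :=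
    fun hz => .of_norm_bounded (summable_geometric_two.mul_left B) fun k =>
      norm_taylorTerm_le k hR hz (cauchy_lim k)
  have mem_ball : ∀ᶠ q : τ × ℂ in l ×ˢ 𝓟 (Metric.closedBall 0 R), ‖q.2‖ ≤ R :=
    tendsto_snd.eventually (p := fun z : ℂ => ‖z‖ ≤ R) (by simp)
  -- uniform convergence on the disc is a limit along `l ×ˢ 𝓟 (closedBall 0 R)`
  have key : Tendsto (fun q : τ × ℂ =>
      ∑' k : ℕ, (k ! : ℂ)⁻¹ • q.2 ^ k • (c k - iteratedDeriv k (F q.1) 0))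
      (l ×ˢ 𝓟 (Metric.closedBall 0 R)) (𝓝 (∑' _ : ℕ, 0)) := by
    refine tendsto_tsum_of_dominated_convergence (summable_geometric_two.mul_left (2 * B))
      (fun k => ?_) ?_
    · have hdiff : Tendsto (fun q : τ × ℂ => c k - iteratedDeriv k (F q.1) 0)
          (l ×ˢ 𝓟 (Metric.closedBall 0 R)) (𝓝 0) := by
        simpa using ((hc k).comp tendsto_fst).const_sub (c k)
      have hbdd : IsBoundedUnder (· ≤ ·) (l ×ˢ 𝓟 (Metric.closedBall 0 R))
          fun q : τ × ℂ => ‖q.2 ^ k‖ :=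
        isBoundedUnder_of_eventually_le (a := R ^ k) <| mem_ball.mono fun q hq => by
          rw [norm_pow]; gcongr
      simpa using (hbdd.smul_tendsto_zero hdiff).const_smul (k ! : ℂ)⁻¹
    · filter_upwards [tendsto_fst.eventually cauchy, mem_ball] with q hq hz k
      refine norm_taylorTerm_le k hR hz ((norm_sub_le _ _).trans ?_)
      refine (add_le_add (cauchy_lim k) (hq k)).trans_eq (by ring)
  rw [tendstoUniformlyOn_iff_tendsto, tendsto_uniformity_iff_dist_tendsto_zero]
  simp only [tsum_zero] at key
  refine (tendsto_zero_iff_norm_tendsto_zero.1 key).congr' (mem_ball.mono fun q hz => ?_)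
  have hsum := Complex.hasSum_taylorSeries_of_entire (hF q.1) 0 q.2
  simp only [sub_zero] at hsum
  simp only [dist_eq_norm, smul_sub]
  rw [(summable_lim hz).tsum_sub hsum.summable, hsum.tsum_eq]

theorem exists_tendstoUniformlyOn_of_tendsto_iteratedDeriv [l.NeBot]
    (hF : ∀ n, Differentiable ℂ (F n))
    (hc : ∀ k, ∃ c, Tendsto (fun n => iteratedDeriv k (F n) 0) l (𝓝 c))
    (hB : ∀ R : ℝ, ∃ B, ∀ᶠ n in l, ∀ z, ‖z‖ ≤ R → ‖F n z‖ ≤ B) :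
    ∃ g : ℂ → E, Differentiable ℂ g ∧ ∀ K, IsCompact K → TendstoUniformlyOn F g l K := by
  choose c hc using hc
  have hconv : ∀ K, IsCompact K →
      TendstoUniformlyOn F (fun z => ∑' k : ℕ, (k ! : ℂ)⁻¹ • z ^ k • c k) l K := fun K hK => by
    obtain ⟨R, hR, hKR⟩ := hK.isBounded.subset_closedBall_lt 0 0
    obtain ⟨B, hB⟩ := hB (2 * R)
    exact (tendstoUniformlyOn_closedBall_of_tendsto_iteratedDeriv hR hF hc hB).mono hKR
  refine ⟨_, ?_, hconv⟩
  rw [← differentiableOn_univ]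
  exact ((tendstoLocallyUniformlyOn_iff_forall_isCompact isOpen_univ).2
    fun K _ hK => hconv K hK).differentiableOn
    (.of_forall fun n => (hF n).differentiableOn) isOpen_univ

end LimitsOfEntireFunctions

section Series

variable {τ ι E : Type*} {l : Filter τ} [l.NeBot] [NormedAddCommGroup E] [NormedSpace ℝ E]

theorem summable_and_tsum_le_of_tendsto {a : τ → ι → ℝ} {a' : ι → ℝ} {S : τ → ℝ} {S' : ℝ}
    (ha : ∀ᶠ n in l, ∀ j, 0 ≤ a n j) (hs : ∀ᶠ n in l, Summable (a n))
    (hle : ∀ᶠ n in l, ∑' j, a n j ≤ S n) (hS : Tendsto S l (𝓝 S'))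
    (hlim : ∀ j, Tendsto (fun n => a n j) l (𝓝 (a' j))) :
    Summable a' ∧ ∑' j, a' j ≤ S' := by
  have nonneg : ∀ j, 0 ≤ a' j := fun j => ge_of_tendsto (hlim j) (ha.mono fun n h => h j)
  have partial_le : ∀ s : Finset ι, ∑ j ∈ s, a' j ≤ S' := fun s => by
    refine le_of_tendsto_of_tendsto (tendsto_finsetSum s fun j _ => hlim j) hS ?_
    filter_upwards [ha, hs, hle] with n ha hs hle
    exact (hs.sum_le_tsum s fun j _ => ha j).trans hle
  exact ⟨summable_of_sum_le nonneg partial_le, Real.tsum_le_of_sum_le nonneg partial_le⟩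

theorem norm_tsum_smul_sub_sum_le [CompleteSpace E] {a : ι → ℝ} {u : ι → E} {s : Finset ι} {δ : ℝ}
    (ha : ∀ j, 0 ≤ a j) (hs : Summable a) (hδ : 0 ≤ δ) (hu : ∀ j ∉ s, ‖u j‖ ≤ δ) :
    ‖∑' j, a j • u j - ∑ j ∈ s, a j • u j‖ ≤ (∑' j, a j) * δ := by
  have bound : ∀ j : {j // j ∉ s}, ‖a j • u j‖ ≤ a j * δ := fun j => by
    rw [norm_smul, Real.norm_of_nonneg (ha j)]
    exact mul_le_mul_of_nonneg_left (hu j j.2) (ha j)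
  have tail : HasSum (fun j : {j // j ∉ s} => a j * δ) ((∑' j : {j // j ∉ s}, a j) * δ) :=
    (hs.subtype {j | j ∉ s}).hasSum.mul_right δ
  have hau : Summable fun j => a j • u j :=
    s.summable_compl_iff.1 (.of_norm_bounded tail.summable bound)
  rw [← hau.sum_add_tsum_subtype_compl s, add_sub_cancel_left]
  exact (tsum_of_norm_bounded tail bound).trans
    (mul_le_mul_of_nonneg_right (hs.tsum_subtype_le _ {j | j ∉ s} ha) hδ)

/-- The weights `a n` may lose mass in the limit, but only at indices where `u` is small. -/
theorem tendsto_tsum_smul_of_tendsto_cofinite_zero [CompleteSpace E] {a : τ → ι → ℝ}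
    {a' : ι → ℝ} {u : τ → ι → E} {u' : ι → E} {b : ι → ℝ} {M : ℝ}
    (ha : ∀ᶠ n in l, ∀ j, 0 ≤ a n j) (hs : ∀ᶠ n in l, Summable (a n))
    (hM : ∀ᶠ n in l, ∑' j, a n j ≤ M) (hu : ∀ᶠ n in l, ∀ j, ‖u n j‖ ≤ b j)
    (hb : Tendsto b cofinite (𝓝 0)) (hal : ∀ j, Tendsto (fun n => a n j) l (𝓝 (a' j)))
    (hul : ∀ j, Tendsto (fun n => u n j) l (𝓝 (u' j))) :
    Tendsto (fun n => ∑' j, a n j • u n j) l (𝓝 (∑' j, a' j • u' j)) := by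
  have uniform : TendstoUniformlyOnFilter (fun (s : Finset ι) n => ∑ j ∈ s, a n j • u n j)
      (fun n => ∑' j, a n j • u n j) atTop l := by
    rw [Metric.tendstoUniformlyOnFilter_iff]
    intro ε hε
    obtain ⟨δ, hδ, hMδ⟩ := exists_pos_mul_lt hε M
    have small : {j | ¬ b j < δ}.Finite := hb.eventually_lt_const hδ
    filter_upwards [(eventually_ge_atTop small.toFinset).prod_mk (ha.and (hs.and (hM.and hu)))]
    rintro ⟨s, n⟩ ⟨hsmall, ha, hs, hM, hu⟩
    rw [dist_eq_norm]
    refine (norm_tsum_smul_sub_sum_le ha hs hδ.le fun j hj => ?_).trans_lt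
      ((mul_le_mul_of_nonneg_right hM hδ.le).trans_lt hMδ)
    by_contra! h
    exact hj (hsmall (small.mem_toFinset.2 (h.le.trans (hu j)).not_gt))
  have summable_lim : Summable fun j => a' j • u' j := by
    obtain ⟨hs', -⟩ := summable_and_tsum_le_of_tendsto ha hs hM tendsto_const_nhds hal
    obtain ⟨B, hB⟩ := hb.bddAbove_range_of_cofinite
    refine .of_norm_bounded (hs'.norm.mul_right B) fun j => ?_
    rw [norm_smul]
    gcongr
    exact (le_of_tendsto (hul j).norm (hu.mono fun n h => h j)).trans (hB ⟨j, rfl⟩)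
  exact uniform.tendsto_of_eventually_tendsto
    (.of_forall fun s => tendsto_finsetSum s fun j _ => (hal j).smul (hul j)) summable_lim.hasSum

end Series

section PowerSums

variable {τ ι : Type*}

theorem ofReal_norm_sq_eq (w : ℂ) : ((‖w‖ ^ 2 : ℝ) : ℂ) = 2 * w.re • w - w ^ 2 := by
  rw [Complex.sq_norm, Complex.normSq_apply]
  apply Complex.ext <;> simp [sq] <;> ring

theorem summable_norm_sq {x : ι → ℂ} (hx : Summable x) : Summable fun j => ‖x j‖ ^ 2 := by
  simpa only [Function.comp_def, norm_mul, ← sq] using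
    (hx.norm.mul_norm hx.norm).comp_injective (i := fun j => (j, j))
      fun _ _ h => congrArg Prod.fst h

theorem summable_re_smul {x : ι → ℂ} (hx : Summable fun j => ‖x j‖ ^ 2) :
    Summable fun j => (x j).re • x j :=
  .of_norm_bounded hx fun j => by
    rw [norm_smul, sq]
    gcongr
    exact Complex.abs_re_le_norm _

theorem ofReal_tsum_norm_sq {x : ι → ℂ} (hx : Summable fun j => ‖x j‖ ^ 2) :
    ((∑' j, ‖x j‖ ^ 2 : ℝ) : ℂ) = 2 * ∑' j, (x j).re • x j - ∑' j, x j ^ 2 := by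
  have hsq : Summable fun j => x j ^ 2 := .of_norm (by simpa only [norm_pow] using hx)
  rw [Complex.ofReal_tsum, ← tsum_mul_left, ← ((summable_re_smul hx).mul_left 2).tsum_sub hsq]
  simp only [ofReal_norm_sq_eq]

theorem tsum_norm_sq_le {x : ι → ℂ} (hx : Summable x) (hre : ∀ j, 0 ≤ (x j).re) :
    ∑' j, ‖x j‖ ^ 2 ≤ 2 * ‖∑' j, x j‖ ^ 2 + ‖∑' j, x j ^ 2‖ := by
  have hxre : HasSum (fun j => (x j).re) (∑' j, x j).re := Complex.hasSum_re hx.hasSum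
  have re_smul_le : (∑' j, (x j).re • x j).re ≤ ‖∑' j, x j‖ ^ 2 := by
    refine le_trans ?_ (Complex.sq_norm_sub_sq_im _ ▸ sub_le_self _ (sq_nonneg _) :
      (∑' j, x j).re ^ 2 ≤ ‖∑' j, x j‖ ^ 2)
    rw [sq]
    refine hasSum_le (fun j => ?_)
      (Complex.hasSum_re (summable_re_smul (summable_norm_sq hx)).hasSum) (hxre.mul_left _)
    rw [Complex.smul_re, smul_eq_mul]
    exact mul_le_mul_of_nonneg_right (le_hasSum hxre j fun i _ => hre i) (hre j)
  have neg_re_le : -(∑' j, x j ^ 2).re ≤ ‖∑' j, x j ^ 2‖ :=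
    (neg_le_abs _).trans (Complex.abs_re_le_norm _)
  have h := congrArg Complex.re (ofReal_tsum_norm_sq (summable_norm_sq hx))
  simp only [Complex.ofReal_re, Complex.sub_re, Complex.mul_re, Complex.re_ofNat,
    Complex.im_ofNat, zero_mul, sub_zero] at h
  linarith

variable {l : Filter τ} [l.NeBot] {x : τ → ι → ℂ} {y : ι → ℂ} {s₁ s₂ : ℂ}

theorem summable_re_and_tsum_re_le_of_tendsto (hx : ∀ᶠ n in l, Summable (x n))
    (hre : ∀ᶠ n in l, ∀ j, 0 ≤ (x n j).re) (hy : ∀ j, Tendsto (fun n => x n j) l (𝓝 (y j)))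
    (h₁ : Tendsto (fun n => ∑' j, x n j) l (𝓝 s₁)) :
    (Summable fun j => (y j).re) ∧ ∑' j, (y j).re ≤ s₁.re :=
  summable_and_tsum_le_of_tendsto hre
    (hx.mono fun _ h => (Complex.hasSum_re h.hasSum).summable)
    (hx.mono fun _ h => (Complex.re_tsum h).ge) ((Complex.continuous_re.tendsto s₁).comp h₁)
    fun j => (Complex.continuous_re.tendsto _).comp (hy j)

theorem tendsto_tsum_re_smul {b : ι → ℝ} (hx : ∀ᶠ n in l, Summable (x n))
    (hre : ∀ᶠ n in l, ∀ j, 0 ≤ (x n j).re) (hxb : ∀ᶠ n in l, ∀ j, ‖x n j‖ ≤ b j)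
    (hb : Tendsto b cofinite (𝓝 0)) (hy : ∀ j, Tendsto (fun n => x n j) l (𝓝 (y j)))
    (h₁ : Tendsto (fun n => ∑' j, x n j) l (𝓝 s₁)) :
    Tendsto (fun n => ∑' j, (x n j).re • x n j) l (𝓝 (∑' j, (y j).re • y j)) := by
  refine tendsto_tsum_smul_of_tendsto_cofinite_zero (M := s₁.re + 1) hre
    (hx.mono fun _ h => (Complex.hasSum_re h.hasSum).summable) ?_ hxb hb
    (fun j => (Complex.continuous_re.tendsto _).comp (hy j)) hy
  have h₁re := (Complex.continuous_re.tendsto s₁).comp h₁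
  filter_upwards [hx, h₁re.eventually_le_const (lt_add_one _)] with n hx h
  rwa [← Complex.re_tsum hx]

/-- The real number `2α` is the mass that `∑ ‖x n j‖²` loses in the limit: since
`‖w‖² + w² = 2 (re w) w`, and no mass of `∑ (re w) w` is lost, `∑ (x n j)²` gains as much. -/
theorem exists_tsum_sq_eq_add_of_tendsto {b : ι → ℝ} (hx : ∀ᶠ n in l, Summable (x n))
    (hre : ∀ᶠ n in l, ∀ j, 0 ≤ (x n j).re) (hxb : ∀ᶠ n in l, ∀ j, ‖x n j‖ ≤ b j)
    (hb : Tendsto b cofinite (𝓝 0)) (hy : ∀ j, Tendsto (fun n => x n j) l (𝓝 (y j)))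
    (h₁ : Tendsto (fun n => ∑' j, x n j) l (𝓝 s₁))
    (h₂ : Tendsto (fun n => ∑' j, x n j ^ 2) l (𝓝 s₂)) :
    (Summable fun j => ‖y j‖ ^ 2) ∧ ∃ α : ℝ, 0 ≤ α ∧ ∑' j, y j ^ 2 = s₂ + 2 * α := by
  set N : ℂ := 2 * ∑' j, (y j).re • y j - s₂ with hN
  have norm_sq_tendsto : Tendsto (fun n => ((∑' j, ‖x n j‖ ^ 2 : ℝ) : ℂ)) l (𝓝 N) := by
    refine (((tendsto_tsum_re_smul hx hre hxb hb hy h₁).const_mul 2).sub h₂).congr' ?_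
    exact hx.mono fun n h => (ofReal_tsum_norm_sq (summable_norm_sq h)).symm
  have norm_sq_re_tendsto : Tendsto (fun n => ∑' j, ‖x n j‖ ^ 2) l (𝓝 N.re) :=
    (Complex.continuous_re.tendsto N).comp norm_sq_tendsto
  have N_real : (N.re : ℂ) = N :=
    tendsto_nhds_unique norm_sq_re_tendsto.ofReal norm_sq_tendsto
  obtain ⟨hy2, hle⟩ := summable_and_tsum_le_of_tendsto (a := fun n j => ‖x n j‖ ^ 2)
    (.of_forall fun _ _ => sq_nonneg _) (hx.mono fun _ h => summable_norm_sq h)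
    (.of_forall fun _ => le_rfl) norm_sq_re_tendsto fun j => (hy j).norm.pow 2
  refine ⟨hy2, (N.re - ∑' j, ‖y j‖ ^ 2) / 2, by linarith, ?_⟩
  have h := ofReal_tsum_norm_sq hy2
  push_cast [N_real] at h ⊢
  linear_combination h - hN

end PowerSums

section WeierstrassFactors

/-- The Weierstrass elementary factor `E_p(u)` of genus `p`. -/
noncomputable def weierstrassFactor (p : ℕ) (u : ℂ) : ℂ :=
  (1 - u) * Complex.exp (∑ k ∈ Finset.range p, u ^ (k + 1) / (k + 1))

theorem weierstrassFactor_zero (u : ℂ) : weierstrassFactor 0 u = 1 - u := by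
  simp [weierstrassFactor]

theorem weierstrassFactor_one (u : ℂ) : weierstrassFactor 1 u = (1 - u) * Complex.exp u := by
  simp [weierstrassFactor]

theorem weierstrassFactor_succ (p : ℕ) (u : ℂ) :
    weierstrassFactor (p + 1) u = weierstrassFactor p u * Complex.exp (u ^ (p + 1) / (p + 1)) := by
  simp only [weierstrassFactor, Finset.sum_range_succ, Complex.exp_add, mul_assoc]

theorem weierstrassFactor_apply_zero (p : ℕ) : weierstrassFactor p 0 = 1 := by
  simp [weierstrassFactor]

theorem hasDerivAt_weierstrassFactor (p : ℕ) (u : ℂ) :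
    HasDerivAt (weierstrassFactor p)
      (-u ^ p * Complex.exp (∑ k ∈ Finset.range p, u ^ (k + 1) / (k + 1))) u := by
  have hsum : HasDerivAt (fun u : ℂ => ∑ k ∈ Finset.range p, u ^ (k + 1) / (k + 1))
      (∑ k ∈ Finset.range p, u ^ k) u := by
    refine HasDerivAt.fun_sum fun k _ => ((hasDerivAt_pow (k + 1) u).div_const _).congr_deriv ?_
    have : (k + 1 : ℂ) ≠ 0 := Nat.cast_add_one_ne_zero k
    push_cast
    exact mul_div_cancel_left₀ _ this
  refine (((hasDerivAt_id u).const_sub 1).mul hsum.cexp).congr_deriv ?_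
  simp only [id_eq]
  linear_combination Complex.exp (∑ k ∈ Finset.range p, u ^ (k + 1) / (k + 1)) *
    mul_neg_geom_sum u p

theorem norm_weierstrassFactor_sub_one_le (p : ℕ) {u : ℂ} {R : ℝ} (hu : ‖u‖ ≤ R) :
    ‖weierstrassFactor p u - 1‖ ≤
      Real.exp (∑ k ∈ Finset.range p, R ^ (k + 1) / (k + 1)) * ‖u‖ ^ (p + 1) := by
  have deriv_le : ∀ w ∈ Metric.closedBall (0 : ℂ) ‖u‖,
      ‖-w ^ p * Complex.exp (∑ k ∈ Finset.range p, w ^ (k + 1) / (k + 1))‖ ≤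
        ‖u‖ ^ p * Real.exp (∑ k ∈ Finset.range p, R ^ (k + 1) / (k + 1)) := fun w hw => by
    rw [mem_closedBall_zero_iff] at hw
    rw [norm_mul, norm_neg, norm_pow]
    gcongr
    refine (Complex.norm_exp_le_exp_norm _).trans ?_
    gcongr
    refine norm_sum_le_of_le _ fun k _ => ?_
    rw [norm_div, norm_pow, ← Nat.cast_add_one, Complex.norm_natCast, Nat.cast_add_one]
    gcongr
    exact hw.trans hu
  have h := (convex_closedBall (0 : ℂ) ‖u‖).norm_image_sub_le_of_norm_hasDerivWithin_le
    (fun w _ => (hasDerivAt_weierstrassFactor p w).hasDerivWithinAt) deriv_le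
    (Metric.mem_closedBall_self (norm_nonneg u)) (mem_closedBall_zero_iff.2 le_rfl)
  rw [weierstrassFactor_apply_zero, sub_zero] at h
  exact h.trans_eq (by ring)

theorem norm_weierstrassFactor_one_le (u : ℂ) :
    ‖weierstrassFactor 1 u‖ ≤ Real.exp (‖u‖ ^ 2 / 2) := by
  have norm_sq : ‖1 - u‖ ^ 2 = 1 - 2 * u.re + ‖u‖ ^ 2 := by
    simpa using norm_sub_sq_real 1 u
  have norm_le : ‖1 - u‖ ≤ Real.exp (-u.re + ‖u‖ ^ 2 / 2) := by
    refine le_of_sq_le_sq ?_ (Real.exp_pos _).le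
    rw [norm_sq, ← Real.exp_nat_mul]
    refine le_trans ?_ (Real.add_one_le_exp _)
    push_cast
    linarith
  rw [weierstrassFactor_one, norm_mul, Complex.norm_exp]
  calc ‖1 - u‖ * Real.exp u.re ≤ Real.exp (-u.re + ‖u‖ ^ 2 / 2) * Real.exp u.re := by gcongr
    _ = Real.exp (‖u‖ ^ 2 / 2) := by rw [← Real.exp_add]; congr 1; ring

variable {τ ι : Type*} {p : ℕ} {u : ι → ℂ} {P s : ℂ}

theorem hasProd_weierstrassFactor_succ_iff (hs : HasSum (fun j => u j ^ (p + 1)) s) :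
    HasProd (fun j => weierstrassFactor (p + 1) (u j)) (P * Complex.exp (s / (p + 1))) ↔
      HasProd (fun j => weierstrassFactor p (u j)) P := by
  have hexp := (hs.div_const (p + 1 : ℂ)).cexp
  have hexp_neg := (hs.div_const (p + 1 : ℂ)).neg.cexp
  simp only [weierstrassFactor_succ]
  refine ⟨fun h => ?_, fun h => h.mul hexp⟩
  simpa [mul_assoc, ← Complex.exp_add] using h.mul hexp_neg

theorem norm_le_exp_of_hasProd_weierstrassFactor_one {S : ℝ}
    (hP : HasProd (fun j => weierstrassFactor 1 (u j)) P) (hS : HasSum (fun j => ‖u j‖ ^ 2) S) :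
    ‖P‖ ≤ Real.exp (S / 2) := by
  refine le_of_tendsto_of_tendsto' (Tendsto.norm hP)
    ((Real.continuous_exp.tendsto _).comp (hS.div_const 2)) fun s => ?_
  rw [Function.comp_apply, norm_prod, Real.exp_sum]
  gcongr
  exact norm_weierstrassFactor_one_le _

theorem norm_le_exp_of_hasProd_one_sub {x : ι → ℂ} {z : ℂ} (hx : HasSum x s)
    (hP : HasProd (fun j => 1 - x j * z) P) :
    ‖P‖ ≤ Real.exp (‖s‖ * ‖z‖ + (∑' j, ‖x j‖ ^ 2) * ‖z‖ ^ 2 / 2) := by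
  have hP₁ : HasProd (fun j => weierstrassFactor 1 (x j * z)) (P * Complex.exp (s * z)) := by
    have h := (hasProd_weierstrassFactor_succ_iff (p := 0) (u := fun j => x j * z) (P := P)
      (s := s * z) (by simpa using hx.mul_right z)).2 (by simpa [weierstrassFactor_zero] using hP)
    simpa using h
  have h := norm_le_exp_of_hasProd_weierstrassFactor_one hP₁
    (by simpa only [norm_mul, mul_pow] using (summable_norm_sq hx.summable).hasSum.mul_right _)
  calc ‖P‖ = ‖P * Complex.exp (s * z)‖ * ‖Complex.exp (-(s * z))‖ := by
        rw [← norm_mul, mul_assoc, ← Complex.exp_add, add_neg_cancel, Complex.exp_zero, mul_one]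
    _ ≤ Real.exp ((∑' j, ‖x j‖ ^ 2) * ‖z‖ ^ 2 / 2) * Real.exp (‖s‖ * ‖z‖) := by
        gcongr
        refine (Complex.norm_exp_le_exp_norm _).trans_eq ?_
        rw [norm_neg, norm_mul]
    _ = Real.exp (‖s‖ * ‖z‖ + (∑' j, ‖x j‖ ^ 2) * ‖z‖ ^ 2 / 2) := by
        rw [← Real.exp_add, add_comm]

theorem exists_norm_weierstrassFactor_sub_one_le {b : ι → ℝ}
    (hb : Summable fun j => b j ^ (p + 1)) :
    ∃ C, ∀ j w, ‖w‖ ≤ b j → ‖weierstrassFactor p w - 1‖ ≤ C * b j ^ (p + 1) := by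
  obtain ⟨T, hT⟩ := hb.tendsto_cofinite_zero.bddAbove_range_of_cofinite
  refine ⟨Real.exp (∑ k ∈ Finset.range p, max 1 T ^ (k + 1) / (k + 1)), fun j w hw => ?_⟩
  have b_le : b j ≤ max 1 T := by
    rcases le_total (b j) 1 with h | h
    · exact le_max_of_le_left h
    · exact le_max_of_le_right ((le_self_pow₀ h p.succ_ne_zero).trans (hT ⟨j, rfl⟩))
  refine (norm_weierstrassFactor_sub_one_le p (hw.trans b_le)).trans ?_
  gcongr

theorem multipliable_weierstrassFactor (hu : Summable fun j => ‖u j‖ ^ (p + 1)) :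
    Multipliable fun j => weierstrassFactor p (u j) := by
  obtain ⟨C, hC⟩ := exists_norm_weierstrassFactor_sub_one_le hu
  simpa only [add_sub_cancel] using multipliable_one_add_of_summable
    (f := fun j => weierstrassFactor p (u j) - 1)
    (.of_nonneg_of_le (fun _ => norm_nonneg _) (fun j => hC j _ le_rfl) (hu.mul_left C))

theorem tendsto_tprod_weierstrassFactor {l : Filter τ} {v : τ → ι → ℂ} {b : ι → ℝ}
    (hb : Summable fun j => b j ^ (p + 1)) (hvb : ∀ᶠ n in l, ∀ j, ‖v n j‖ ≤ b j)
    (hvu : ∀ j, Tendsto (fun n => v n j) l (𝓝 (u j))) :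
    Tendsto (fun n => ∏' j, weierstrassFactor p (v n j)) l
      (𝓝 (∏' j, weierstrassFactor p (u j))) := by
  obtain ⟨C, hC⟩ := exists_norm_weierstrassFactor_sub_one_le hb
  have cont : Continuous (weierstrassFactor p) :=
    continuous_iff_continuousAt.2 fun w => (hasDerivAt_weierstrassFactor p w).continuousAt
  simpa only [add_sub_cancel] using tendsto_tprod_one_add_of_dominated_convergence
    (f := fun n j => weierstrassFactor p (v n j) - 1) (hb.mul_left C)
    (fun j => ((cont.tendsto _).comp (hvu j)).sub_const 1)
    (hvb.mono fun n h j => hC j _ (h j))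

end WeierstrassFactors

section HadamardForm

variable {τ ι : Type*}

/-- `h(z) = e^{αz² - βz} ∏ⱼ (1 - yⱼz) e^{yⱼz}` with the constraints on `α`, `β` and `yⱼ` that limits
of polynomials with zeros in the closed right half plane satisfy. The `yⱼ` are the reciprocals of
the zeros of `h`; the value `yⱼ = 0` is allowed and contributes a trivial factor. -/
structure IsHadamardForm (h : ℂ → ℂ) (α : ℝ) (β : ℂ) (y : ι → ℂ) : Prop where
  nonneg : 0 ≤ α
  re_nonneg : ∀ j, 0 ≤ (y j).re
  summable_norm_sq : Summable fun j => ‖y j‖ ^ 2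
  summable_re : Summable fun j => (y j).re
  tsum_re_le : ∑' j, (y j).re ≤ β.re
  hasProd : ∀ z, HasProd (fun j => weierstrassFactor 1 (y j * z))
    (h z * Complex.exp (β * z - α * z ^ 2))

theorem tendsto_zero_of_summable_pow {b : ι → ℝ} {p : ℕ} (hp : p ≠ 0) (hb : ∀ j, 0 ≤ b j)
    (hs : Summable fun j => b j ^ p) : Tendsto b cofinite (𝓝 0) := by
  have h := hs.tendsto_cofinite_zero.rpow_const (p := (p : ℝ)⁻¹) (.inr (by positivity))
  rw [Real.zero_rpow (by positivity)] at h
  exact h.congr fun j => Real.pow_rpow_inv_natCast (hb j) hp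

variable {l : Filter τ} {x : τ → ι → ℂ} {y : ι → ℂ} {s₁ s₂ : ℂ} {F : τ → ℂ → ℂ} {h : ℂ → ℂ}

theorem hasProd_weierstrassFactor_two_of_tendsto [l.NeBot] {b : ι → ℝ}
    (hx : ∀ᶠ n in l, Summable (x n)) (hxb : ∀ᶠ n in l, ∀ j, ‖x n j‖ ≤ b j)
    (hb : Summable fun j => b j ^ 3) (hy : ∀ j, Tendsto (fun n => x n j) l (𝓝 (y j)))
    (h₁ : Tendsto (fun n => ∑' j, x n j) l (𝓝 s₁))
    (h₂ : Tendsto (fun n => ∑' j, x n j ^ 2) l (𝓝 s₂)) {z : ℂ}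
    (hF : ∀ᶠ n in l, HasProd (fun j => 1 - x n j * z) (F n z))
    (hFh : Tendsto (fun n => F n z) l (𝓝 (h z))) :
    HasProd (fun j => weierstrassFactor 2 (y j * z))
      (h z * Complex.exp (s₁ * z) * Complex.exp (s₂ * z ^ 2 / 2)) := by
  have hprod : ∀ᶠ n in l, HasProd (fun j => weierstrassFactor 2 (x n j * z))
      (F n z * Complex.exp ((∑' j, x n j) * z) *
        Complex.exp ((∑' j, x n j ^ 2) * z ^ 2 / 2)) := by
    filter_upwards [hx, hF] with n hx hF
    have hx2 : Summable fun j => x n j ^ 2 :=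
      .of_norm (by simpa only [norm_pow] using summable_norm_sq hx)
    have e₁ := (hasProd_weierstrassFactor_succ_iff (p := 0)
      (by simpa using hx.hasSum.mul_right z)).2 (by simpa [weierstrassFactor_zero] using hF)
    have e₂ := (hasProd_weierstrassFactor_succ_iff (p := 1)
      (by simpa [mul_pow] using hx2.hasSum.mul_right (z ^ 2))).2 e₁
    simpa [one_add_one_eq_two] using e₂
  have hlim := tendsto_tprod_weierstrassFactor (p := 2) (l := l) (v := fun n j => x n j * z)
    (u := fun j => y j * z) (b := fun j => b j * ‖z‖)
    (by simpa only [mul_pow] using hb.mul_right (‖z‖ ^ 3))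
    (hxb.mono fun n h j => by rw [norm_mul]; gcongr; exact h j) fun j => (hy j).mul_const z
  have hyb : ∀ j, ‖y j‖ ≤ b j := fun j => le_of_tendsto (hy j).norm (hxb.mono fun n h => h j)
  have hmul : Multipliable fun j => weierstrassFactor 2 (y j * z) := by
    refine multipliable_weierstrassFactor
      (.of_nonneg_of_le (fun _ => by positivity) (fun j => ?_) (hb.mul_right (‖z‖ ^ 3)))
    rw [norm_mul, mul_pow]
    gcongr
    exact hyb j
  have heq := tendsto_nhds_unique (hlim.congr' (hprod.mono fun n h => h.tprod_eq))
    ((hFh.mul (h₁.mul_const z).cexp).mul ((h₂.mul_const (z ^ 2)).div_const 2).cexp)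
  exact heq ▸ hmul.hasProd

theorem exists_isHadamardForm_of_tendsto [l.NeBot] {b : ι → ℝ}
    (hx : ∀ᶠ n in l, Summable (x n)) (hre : ∀ᶠ n in l, ∀ j, 0 ≤ (x n j).re)
    (hxb : ∀ᶠ n in l, ∀ j, ‖x n j‖ ≤ b j) (hb : Summable fun j => b j ^ 3)
    (hy : ∀ j, Tendsto (fun n => x n j) l (𝓝 (y j)))
    (h₁ : Tendsto (fun n => ∑' j, x n j) l (𝓝 s₁))
    (h₂ : Tendsto (fun n => ∑' j, x n j ^ 2) l (𝓝 s₂))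
    (hF : ∀ᶠ n in l, ∀ z, HasProd (fun j => 1 - x n j * z) (F n z))
    (hFh : ∀ z, Tendsto (fun n => F n z) l (𝓝 (h z))) :
    ∃ α, IsHadamardForm h α s₁ y := by
  obtain ⟨n, hn⟩ := hxb.exists
  have hb0 : Tendsto b cofinite (𝓝 0) :=
    tendsto_zero_of_summable_pow three_ne_zero (fun j => (norm_nonneg _).trans (hn j)) hb
  obtain ⟨hyre, hyle⟩ := summable_re_and_tsum_re_le_of_tendsto hx hre hy h₁
  obtain ⟨hy2, α, hα, hsq⟩ := exists_tsum_sq_eq_add_of_tendsto hx hre hxb hb0 hy h₁ h₂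
  have hysq : HasSum (fun j => y j ^ 2) (s₂ + 2 * α) :=
    hsq ▸ (Summable.of_norm (by simpa only [norm_pow] using hy2)).hasSum
  refine ⟨α, hα, fun j => ?_, hy2, hyre, hyle, fun z => ?_⟩
  · exact ge_of_tendsto ((Complex.continuous_re.tendsto _).comp (hy j)) (hre.mono fun n h => h j)
  · refine (hasProd_weierstrassFactor_succ_iff (p := 1)
      (by simpa [mul_pow] using hysq.mul_right (z ^ 2))).1 ?_
    convert hasProd_weierstrassFactor_two_of_tendsto hx hxb hb hy h₁ h₂ (hF.mono fun n h => h z)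
      (hFh z) using 1
    rw [mul_assoc, mul_assoc, ← Complex.exp_add, ← Complex.exp_add]
    congr 2
    push_cast
    ring

end HadamardForm

section ReciprocalZeros

open Polynomial

section CommRing

variable {R : Type*} [CommRing R] (s : Multiset R)

theorem coeff_zero_prod_one_sub_C_mul_X : (s.map fun a => 1 - C a * X).prod.coeff 0 = 1 := by
  simp [coeff_zero_multiset_prod]

theorem coeff_one_prod_one_sub_C_mul_X :
    (s.map fun a => 1 - C a * X).prod.coeff 1 = -s.sum := by
  induction s using Multiset.induction with
  | empty => simp [coeff_one]
  | cons a s ih =>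
    rw [Multiset.map_cons, Multiset.prod_cons, Multiset.sum_cons, sub_mul, one_mul, mul_assoc,
      coeff_sub, coeff_C_mul, coeff_X_mul, ih, coeff_zero_prod_one_sub_C_mul_X]
    ring

theorem two_mul_coeff_two_prod_one_sub_C_mul_X :
    2 * (s.map fun a => 1 - C a * X).prod.coeff 2 = s.sum ^ 2 - (s.map (· ^ 2)).sum := by
  induction s using Multiset.induction with
  | empty => simp [coeff_one]
  | cons a s ih =>
    rw [Multiset.map_cons, Multiset.prod_cons, Multiset.sum_cons, Multiset.map_cons,
      Multiset.sum_cons, sub_mul, one_mul, mul_assoc, coeff_sub, coeff_C_mul, coeff_X_mul,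
      coeff_one_prod_one_sub_C_mul_X]
    linear_combination ih

end CommRing

theorem eq_C_mul_prod_one_sub_inv_root {K : Type*} [Field K] {p : K[X]} (hp : p.Splits)
    (h0 : p.coeff 0 ≠ 0) :
    p = C (p.coeff 0) * ((p.roots.map (·⁻¹)).map fun b => 1 - C b * X).prod := by
  have factor : ∀ a ∈ p.roots, X - C a = C (-a) * (1 - C a⁻¹ * X) := fun a ha => by
    have ha0 : a ≠ 0 := by
      rintro rfl
      exact h0 ((coeff_zero_eq_eval_zero p).trans (isRoot_of_mem_roots ha))
    have : C a * C a⁻¹ = 1 := by rw [← C_mul, mul_inv_cancel₀ ha0, C_1]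
    rw [C_neg]
    linear_combination -X * this
  obtain ⟨c, hc⟩ :
      ∃ c, p = C c * ((p.roots.map (·⁻¹)).map fun b => 1 - C b * X).prod := by
    refine ⟨p.leadingCoeff * (p.roots.map fun a => -a).prod, hp.eq_prod_roots.trans ?_⟩
    rw [Multiset.map_congr rfl factor, Multiset.prod_map_mul, Multiset.map_map, C_mul, mul_assoc,
      map_multiset_prod, Multiset.map_map]
    rfl
  have c_eq : p.coeff 0 = c := by
    conv_lhs => rw [hc]
    rw [coeff_C_mul, coeff_zero_prod_one_sub_C_mul_X, mul_one]
  rwa [c_eq]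

@[to_additive]
theorem hasProd_getD {α M : Type*} [CommMonoid M] [TopologicalSpace M] (L : List α) {d : α}
    {φ : α → M} (hd : φ d = 1) : HasProd (fun j => φ (L.getD j d)) (L.map φ).prod := by
  have h : (L.map φ).prod = ∏ j ∈ Finset.range L.length, φ (L.getD j d) := by
    rw [Finset.prod_range, ← List.prod_ofFn]
    congr 1
    apply List.ext_getElem <;> simp
  rw [h]
  refine hasProd_prod_of_ne_finset_one fun j hj => ?_
  rw [List.getD_eq_default _ _ (by simpa using hj), hd]

section SortByNorm

variable {E : Type*} [NormedAddCommGroup E] {s : Multiset E}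

/-- The elements of `s`, with multiplicity and by decreasing norm, followed by zeros. -/
noncomputable def sortByNorm (s : Multiset E) (j : ℕ) : E :=
  (s.toList.insertionSort fun a b => ‖b‖ ≤ ‖a‖).getD j 0

@[to_additive]
theorem hasProd_sortByNorm {M : Type*} [CommMonoid M] [TopologicalSpace M] (s : Multiset E)
    {φ : E → M} (hφ : φ 0 = 1) : HasProd (fun j => φ (sortByNorm s j)) (s.map φ).prod := by
  have h := hasProd_getD (s.toList.insertionSort fun a b => ‖b‖ ≤ ‖a‖) hφ
  rwa [((List.perm_insertionSort _ _).map φ).prod_eq, ← Multiset.prod_coe, ← Multiset.map_coe,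
    Multiset.coe_toList] at h

theorem antitone_norm_sortByNorm (s : Multiset E) : Antitone fun j => ‖sortByNorm s j‖ := by
  intro i j hij
  have : Std.Total fun a b : E => ‖b‖ ≤ ‖a‖ := ⟨fun a b => le_total _ _⟩
  have : IsTrans E fun a b => ‖b‖ ≤ ‖a‖ := ⟨fun a b c hab hbc => hbc.trans hab⟩
  have : Std.Refl fun a b : E => ‖b‖ ≤ ‖a‖ := ⟨fun a => le_rfl⟩
  have sorted := List.pairwise_insertionSort (fun a b : E => ‖b‖ ≤ ‖a‖) s.toList
  simp only [sortByNorm]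
  rcases lt_or_ge j (s.toList.insertionSort fun a b => ‖b‖ ≤ ‖a‖).length with hj | hj
  · rw [List.getD_eq_getElem _ _ hj, List.getD_eq_getElem _ _ (hij.trans_lt hj)]
    exact sorted.rel_get_of_le (a := ⟨i, hij.trans_lt hj⟩) (b := ⟨j, hj⟩) hij
  · rw [List.getD_eq_default _ _ hj, norm_zero]
    exact norm_nonneg _

theorem sortByNorm_mem {j : ℕ} (h : sortByNorm s j ≠ 0) : sortByNorm s j ∈ s := by
  unfold sortByNorm at h ⊢
  rcases lt_or_ge j (s.toList.insertionSort fun a b => ‖b‖ ≤ ‖a‖).length with hj | hj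
  · rw [List.getD_eq_getElem _ _ hj, ← Multiset.mem_toList]
    exact (List.mem_insertionSort _).1 (List.getElem_mem hj)
  · exact absurd (List.getD_eq_default _ _ hj) h

end SortByNorm

section NormedField

variable {K : Type*} [NormedField K]

/-- The reciprocals of the zeros of `p`, with multiplicity and by decreasing absolute value,
followed by zeros. It is meant for polynomials that do not vanish at `0`; here `0⁻¹ = 0`. -/
noncomputable def reciprocalZeros (p : K[X]) : ℕ → K := sortByNorm (p.roots.map (·⁻¹))

variable {p : K[X]}

theorem hasProd_one_sub_reciprocalZeros_mul (hp : p.Splits) (h0 : p.coeff 0 ≠ 0) (z : K) :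
    HasProd (fun j => 1 - reciprocalZeros p j * z) (p.eval z / p.coeff 0) := by
  have eval_eq : p.eval z / p.coeff 0 = ((p.roots.map (·⁻¹)).map fun b => 1 - b * z).prod := by
    rw [div_eq_iff h0, mul_comm]
    conv_lhs => rw [eq_C_mul_prod_one_sub_inv_root hp h0]
    simp [eval_multiset_prod]
  rw [eval_eq]
  exact hasProd_sortByNorm (φ := fun b => 1 - b * z) _ (by simp)

theorem hasSum_reciprocalZeros (hp : p.Splits) (h0 : p.coeff 0 ≠ 0) :
    HasSum (reciprocalZeros p) (-(p.coeff 1 / p.coeff 0)) := by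
  have h := congrArg (coeff · 1) (eq_C_mul_prod_one_sub_inv_root hp h0)
  simp only [coeff_C_mul, coeff_one_prod_one_sub_C_mul_X] at h
  rw [h, mul_div_cancel_left₀ _ h0, neg_neg]
  simpa only [Multiset.map_id'] using! hasSum_sortByNorm (p.roots.map (·⁻¹)) (φ := fun b => b) rfl

theorem hasSum_reciprocalZeros_sq (hp : p.Splits) (h0 : p.coeff 0 ≠ 0) :
    HasSum (fun j => reciprocalZeros p j ^ 2)
      ((p.coeff 1 / p.coeff 0) ^ 2 - 2 * (p.coeff 2 / p.coeff 0)) := by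
  have h := eq_C_mul_prod_one_sub_inv_root hp h0
  have h₁ := congrArg (coeff · 1) h
  have h₂ := congrArg (coeff · 2) h
  simp only [coeff_C_mul, coeff_one_prod_one_sub_C_mul_X] at h₁ h₂
  rw [h₁, h₂, mul_div_cancel_left₀ _ h0, mul_div_cancel_left₀ _ h0, neg_sq,
    two_mul_coeff_two_prod_one_sub_C_mul_X, sub_sub_cancel]
  exact hasSum_sortByNorm (φ := (· ^ 2)) _ (zero_pow two_ne_zero)

end NormedField

theorem re_reciprocalZeros_nonneg {p : ℂ[X]} (hp : zeroSet p ⊆ rightHalfPlane) (j : ℕ) :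
    0 ≤ (reciprocalZeros p j).re := by
  by_cases h : reciprocalZeros p j = 0
  · rw [h, Complex.zero_re]
  obtain ⟨a, ha, hinv⟩ := Multiset.mem_map.1 (sortByNorm_mem h)
  have ha_re : 0 ≤ a.re := hp (mem_roots'.1 ha)
  rw [reciprocalZeros, ← hinv, Complex.inv_re]
  exact div_nonneg ha_re (Complex.normSq_nonneg a)

end ReciprocalZeros

section TriangularArrays

theorem le_div_of_antitone_of_tsum_le {a : ℕ → ℝ} {C : ℝ} (ha : Antitone a) (h0 : ∀ j, 0 ≤ a j)
    (hs : Summable a) (hC : ∑' j, a j ≤ C) (j : ℕ) : a j ≤ C / (j + 1) := by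
  rw [le_div_iff₀' (by positivity)]
  calc ((j : ℝ) + 1) * a j = (Finset.range (j + 1)).card • a j := by simp
    _ ≤ ∑ i ∈ Finset.range (j + 1), a i :=
        Finset.card_nsmul_le_sum _ _ _ fun i hi => ha (Nat.le_of_lt_succ (Finset.mem_range.1 hi))
    _ ≤ C := (hs.sum_le_tsum _ fun i _ => h0 i).trans hC

theorem norm_le_sqrt_div_of_antitone {E : Type*} [SeminormedAddGroup E] {x : ℕ → E} {C : ℝ}
    (hx : Antitone fun j => ‖x j‖) (hs : Summable fun j => ‖x j‖ ^ 2)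
    (hC : ∑' j, ‖x j‖ ^ 2 ≤ C) (j : ℕ) : ‖x j‖ ≤ √(C / (j + 1)) :=
  Real.le_sqrt_of_sq_le <| le_div_of_antitone_of_tsum_le
    (fun _ _ h => pow_le_pow_left₀ (norm_nonneg _) (hx h) 2) (fun _ => by positivity) hs hC j

theorem summable_sqrt_div_pow_three (C : ℝ) : Summable fun j : ℕ => √(C / (j + 1)) ^ 3 := by
  have h : Summable fun j : ℕ => 1 / ((j + 1 : ℕ) : ℝ) ^ (3 / 2 : ℝ) :=
    (summable_nat_add_iff 1).2 (Real.summable_one_div_nat_rpow.2 (by norm_num))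
  refine (h.mul_left (√C ^ 3)).congr fun j => ?_
  rw [Real.sqrt_div' _ (by positivity), div_pow, mul_one_div, Real.sqrt_eq_rpow (j + 1 : ℝ),
    ← Real.rpow_mul_natCast (by positivity)]
  norm_num

theorem exists_tendsto_of_norm_le {τ ι E : Type*} [SeminormedAddCommGroup E] [ProperSpace E]
    {U : Ultrafilter τ} {x : τ → ι → E} {b : ι → ℝ} (hxb : ∀ᶠ n in U, ∀ j, ‖x n j‖ ≤ b j) :
    ∃ y : ι → E, ∀ j, Tendsto (fun n => x n j) U (𝓝 (y j)) := by
  have entry : ∀ j, ∃ y, Tendsto (fun n => x n j) U (𝓝 y) := fun j => by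
    obtain ⟨y, -, hy⟩ := (isCompact_closedBall (0 : E) (b j)).ultrafilter_le_nhds'
      (U.map fun n => x n j) (hxb.mono fun n h => mem_closedBall_zero_iff.2 (h j))
    exact ⟨y, hy⟩
  exact ⟨_, fun j => (entry j).choose_spec⟩

variable {τ ι : Type*} {l : Filter τ} {x : τ → ι → ℂ} {s₁ s₂ : ℂ}

theorem exists_tsum_norm_sq_le_of_tendsto (hx : ∀ᶠ n in l, Summable (x n))
    (hre : ∀ᶠ n in l, ∀ j, 0 ≤ (x n j).re) (h₁ : Tendsto (fun n => ∑' j, x n j) l (𝓝 s₁))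
    (h₂ : Tendsto (fun n => ∑' j, x n j ^ 2) l (𝓝 s₂)) :
    ∃ C, ∀ᶠ n in l, ∑' j, ‖x n j‖ ^ 2 ≤ C := by
  have hlim := ((h₁.norm.pow 2).const_mul 2).add h₂.norm
  refine ⟨2 * ‖s₁‖ ^ 2 + ‖s₂‖ + 1, ?_⟩
  filter_upwards [hx, hre, hlim.eventually_le_const (lt_add_one _)] with n hx hre hle
  exact (tsum_norm_sq_le hx hre).trans hle

theorem exists_norm_le_of_hasProd_one_sub {F : τ → ℂ → ℂ} (hx : ∀ᶠ n in l, Summable (x n))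
    (hre : ∀ᶠ n in l, ∀ j, 0 ≤ (x n j).re) (h₁ : Tendsto (fun n => ∑' j, x n j) l (𝓝 s₁))
    (h₂ : Tendsto (fun n => ∑' j, x n j ^ 2) l (𝓝 s₂))
    (hF : ∀ᶠ n in l, ∀ z, HasProd (fun j => 1 - x n j * z) (F n z)) (R : ℝ) :
    ∃ B, ∀ᶠ n in l, ∀ z, ‖z‖ ≤ R → ‖F n z‖ ≤ B := by
  obtain ⟨C, hC⟩ := exists_tsum_norm_sq_le_of_tendsto hx hre h₁ h₂
  refine ⟨Real.exp ((‖s₁‖ + 1) * R + C * R ^ 2 / 2), ?_⟩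
  filter_upwards [hx, hC, hF, h₁.norm.eventually_le_const (lt_add_one _)] with n hx hC hF h₁ z hz
  have hC0 : 0 ≤ C := (tsum_nonneg fun j => sq_nonneg ‖x n j‖).trans hC
  refine (norm_le_exp_of_hasProd_one_sub hx.hasSum (hF z)).trans ?_
  gcongr

end TriangularArrays

section Polynomials

open Polynomial

theorem iteratedDeriv_eval (p : ℂ[X]) (k : ℕ) :
    iteratedDeriv k (fun z => p.eval z) = fun z => (derivative^[k] p).eval z := by
  induction k with
  | zero => simp
  | succ k ih =>
    ext z
    rw [iteratedDeriv_succ, ih, Function.iterate_succ_apply', Polynomial.deriv]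

variable {τ : Type*} {l : Filter τ} {f : τ → ℂ[X]} {c₀ c₁ c₂ : ℂ}

theorem tendsto_coeff_of_tendsto_eval_iterate_derivative {k : ℕ} {c : ℂ}
    (hc : Tendsto (fun n => (derivative^[k] (f n)).eval 0) l (𝓝 c)) :
    Tendsto (fun n => (f n).coeff k) l (𝓝 (c / k.factorial)) :=
  (hc.div_const _).congr fun n => by
    rw [← coeff_zero_eq_eval_zero, coeff_iterate_derivative, zero_add, Nat.descFactorial_self,
      nsmul_eq_mul, mul_div_cancel_left₀ _ (Nat.cast_ne_zero.2 k.factorial_ne_zero)]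

theorem tendsto_tsum_reciprocalZeros (h₀ : Tendsto (fun n => (f n).coeff 0) l (𝓝 c₀))
    (hc₀ : c₀ ≠ 0) (h₁ : Tendsto (fun n => (f n).coeff 1) l (𝓝 c₁)) :
    Tendsto (fun n => ∑' j, reciprocalZeros (f n) j) l (𝓝 (-(c₁ / c₀))) :=
  (h₁.div h₀ hc₀).neg.congr' <| (h₀.eventually_ne hc₀).mono fun n hn =>
    (hasSum_reciprocalZeros (IsAlgClosed.splits (f n)) hn).tsum_eq.symm

theorem tendsto_tsum_reciprocalZeros_sq (h₀ : Tendsto (fun n => (f n).coeff 0) l (𝓝 c₀))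
    (hc₀ : c₀ ≠ 0) (h₁ : Tendsto (fun n => (f n).coeff 1) l (𝓝 c₁))
    (h₂ : Tendsto (fun n => (f n).coeff 2) l (𝓝 c₂)) :
    Tendsto (fun n => ∑' j, reciprocalZeros (f n) j ^ 2) l
      (𝓝 ((c₁ / c₀) ^ 2 - 2 * (c₂ / c₀))) :=
  (((h₁.div h₀ hc₀).pow 2).sub ((h₂.div h₀ hc₀).const_mul 2)).congr' <|
    (h₀.eventually_ne hc₀).mono fun n hn =>
      (hasSum_reciprocalZeros_sq (IsAlgClosed.splits (f n)) hn).tsum_eq.symm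

theorem exists_norm_eval_le (h₀ : Tendsto (fun n => (f n).coeff 0) l (𝓝 c₀)) (hc₀ : c₀ ≠ 0)
    (h₁ : Tendsto (fun n => (f n).coeff 1) l (𝓝 c₁))
    (h₂ : Tendsto (fun n => (f n).coeff 2) l (𝓝 c₂))
    (hzero : ∀ᶠ n in l, zeroSet (f n) ⊆ rightHalfPlane) (R : ℝ) :
    ∃ B, ∀ᶠ n in l, ∀ z, ‖z‖ ≤ R → ‖(f n).eval z‖ ≤ B := by
  have hne := h₀.eventually_ne hc₀
  obtain ⟨B, hB⟩ := exists_norm_le_of_hasProd_one_sub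
    (hne.mono fun n hn => (hasSum_reciprocalZeros (IsAlgClosed.splits (f n)) hn).summable)
    (hzero.mono fun n hn => re_reciprocalZeros_nonneg hn)
    (tendsto_tsum_reciprocalZeros h₀ hc₀ h₁) (tendsto_tsum_reciprocalZeros_sq h₀ hc₀ h₁ h₂)
    (hne.mono fun n hn => hasProd_one_sub_reciprocalZeros_mul (IsAlgClosed.splits (f n)) hn) R
  refine ⟨B * (‖c₀‖ + 1), ?_⟩
  filter_upwards [hB, hne, h₀.norm.eventually_le_const (lt_add_one _)] with n hB hn h₀ z hz
  rw [← div_mul_cancel₀ ((f n).eval z) hn, norm_mul]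
  exact mul_le_mul (hB z hz) h₀ (norm_nonneg _) ((norm_nonneg _).trans (hB z hz))

theorem exists_isHadamardForm [l.NeBot] {g : ℂ → ℂ}
    (hg : ∀ z, Tendsto (fun n => (f n).eval z) l (𝓝 (g z))) (hg0 : g 0 ≠ 0)
    (h₁ : Tendsto (fun n => (f n).coeff 1) l (𝓝 c₁))
    (h₂ : Tendsto (fun n => (f n).coeff 2) l (𝓝 c₂))
    (hzero : ∀ᶠ n in l, zeroSet (f n) ⊆ rightHalfPlane) :
    ∃ (α : ℝ) (β : ℂ) (y : ℕ → ℂ), IsHadamardForm (fun z => g z / g 0) α β y := by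
  have h₀ : Tendsto (fun n => (f n).coeff 0) l (𝓝 (g 0)) := by
    simpa only [coeff_zero_eq_eval_zero] using hg 0
  have hne := h₀.eventually_ne hg0
  have hx : ∀ᶠ n in l, Summable (reciprocalZeros (f n)) := hne.mono fun n hn =>
    (hasSum_reciprocalZeros (IsAlgClosed.splits (f n)) hn).summable
  have hre : ∀ᶠ n in l, ∀ j, 0 ≤ (reciprocalZeros (f n) j).re :=
    hzero.mono fun n hn => re_reciprocalZeros_nonneg hn
  have hs₁ := tendsto_tsum_reciprocalZeros h₀ hg0 h₁
  have hs₂ := tendsto_tsum_reciprocalZeros_sq h₀ hg0 h₁ h₂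
  obtain ⟨C, hC⟩ := exists_tsum_norm_sq_le_of_tendsto hx hre hs₁ hs₂
  have hxb : ∀ᶠ n in l, ∀ j, ‖reciprocalZeros (f n) j‖ ≤ √(C / (j + 1)) := by
    filter_upwards [hx, hC] with n hx hC
    exact norm_le_sqrt_div_of_antitone (antitone_norm_sortByNorm _) (summable_norm_sq hx) hC
  have hF : ∀ᶠ n in l, ∀ z,
      HasProd (fun j => 1 - reciprocalZeros (f n) j * z) ((f n).eval z / (f n).coeff 0) :=
    hne.mono fun n hn => hasProd_one_sub_reciprocalZeros_mul (IsAlgClosed.splits (f n)) hn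
  have hU : ↑(Ultrafilter.of l) ≤ l := Ultrafilter.of_le l
  obtain ⟨y, hy⟩ := exists_tendsto_of_norm_le (hU hxb)
  obtain ⟨α, hα⟩ := exists_isHadamardForm_of_tendsto (hU hx) (hU hre) (hU hxb)
    (summable_sqrt_div_pow_three C) hy (hs₁.mono_left hU) (hs₂.mono_left hU) (hU hF)
    fun z => ((hg z).div h₀ hg0).mono_left hU
  exact ⟨α, _, y, hα⟩

end Polynomials

namespace IsHadamardForm

variable {ι : Type*} {h : ℂ → ℂ} {α : ℝ} {β : ℂ} {y : ι → ℂ}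

theorem restrict_ne_zero (H : IsHadamardForm h α β y) :
    IsHadamardForm h α β fun j : {j // y j ≠ 0} => y j where
  nonneg := H.nonneg
  re_nonneg j := H.re_nonneg j
  summable_norm_sq := H.summable_norm_sq.subtype {j | y j ≠ 0}
  summable_re := H.summable_re.subtype {j | y j ≠ 0}
  tsum_re_le := (H.summable_re.tsum_subtype_le _ {j | y j ≠ 0} H.re_nonneg).trans H.tsum_re_le
  hasProd z := (hasProd_subtype_iff_of_mulSupport_subset (s := {j | y j ≠ 0}) fun j hj h0 =>
    hj (by simp only [h0, zero_mul, weierstrassFactor_apply_zero])).2 (H.hasProd z)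

theorem inv_mem (H : IsHadamardForm h α β y) {j : ι} (hj : y j ≠ 0) :
    (y j)⁻¹ ∈ rightHalfPlane \ {0} := by
  refine ⟨?_, inv_ne_zero hj⟩
  simp only [rightHalfPlane, Set.mem_ofPred_eq, Complex.inv_re]
  exact div_nonneg (H.re_nonneg j) (Complex.normSq_nonneg _)

theorem hasProd_zeros (H : IsHadamardForm h α β y) (z : ℂ) :
    HasProd (fun j => (1 - z / (y j)⁻¹) * Complex.exp (z / (y j)⁻¹))
      (h z * Complex.exp (β * z - α * z ^ 2)) := by
  simpa only [div_inv_eq_mul, mul_comm z, weierstrassFactor_one] using H.hasProd z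

theorem eq_exp_mul_tprod (H : IsHadamardForm h α β y) (z : ℂ) :
    h z = Complex.exp (α * z ^ 2 - β * z) *
      ∏' j, (1 - z / (y j)⁻¹) * Complex.exp (z / (y j)⁻¹) := by
  rw [(H.hasProd_zeros z).tprod_eq, mul_left_comm, ← Complex.exp_add, sub_add_sub_cancel,
    sub_self, Complex.exp_zero, mul_one]

end IsHadamardForm

end PolySeq

theorem theorem2p5_general {τ : Type*} {l : Filter τ} [l.NeBot] (f : τ → Polynomial ℂ)
    (hweak : ∀ k : ℕ, ∃ c : ℂ,
      Tendsto (fun n => ((Polynomial.derivative^[k]) (f n)).eval 0) l (𝓝 c))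
    (h0 : ∃ L : ℂ, L ≠ 0 ∧ Tendsto (fun n => (f n).eval 0) l (𝓝 L))
    (hzero : ∀ᶠ n in l, PolySeq.zeroSet (f n) ⊆ PolySeq.rightHalfPlane) :
    ∃ g : ℂ → ℂ, Differentiable ℂ g ∧
      (∀ K : Set ℂ, IsCompact K → TendstoUniformlyOn (fun n z => (f n).eval z) g l K) ∧
      ∃ (α : ℝ) (β : ℂ) (ι : Type) (_ : Countable ι) (a : ι → ℂ),
        (∀ j, a j ∈ PolySeq.rightHalfPlane \ {0}) ∧
        Summable (fun j => (‖a j‖ ^ 2)⁻¹) ∧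
        (∀ z : ℂ, Multipliable (fun j => (1 - z / a j) * Complex.exp (z / a j)) ∧
          g z = g 0 * Complex.exp ((α : ℂ) * z ^ 2 - β * z) *
            ∏' j, (1 - z / a j) * Complex.exp (z / a j)) ∧
        Summable (fun j => ((a j)⁻¹).re) ∧
        ∑' j, ((a j)⁻¹).re ≤ β.re ∧
        0 ≤ α := by
  obtain ⟨L, hL, h₀⟩ := h0
  have h₁ := PolySeq.tendsto_coeff_of_tendsto_eval_iterate_derivative (hweak 1).choose_spec
  have h₂ := PolySeq.tendsto_coeff_of_tendsto_eval_iterate_derivative (hweak 2).choose_spec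
  obtain ⟨g, hg, hconv⟩ := PolySeq.exists_tendstoUniformlyOn_of_tendsto_iteratedDeriv
    (fun n => (f n).differentiable)
    (fun k => by simpa only [PolySeq.iteratedDeriv_eval] using hweak k)
    (PolySeq.exists_norm_eval_le (by simpa only [Polynomial.coeff_zero_eq_eval_zero] using h₀)
      hL h₁ h₂ hzero)
  have pointwise : ∀ z, Tendsto (fun n => (f n).eval z) l (𝓝 (g z)) := fun z =>
    (hconv {z} isCompact_singleton).tendsto_at rfl
  have g_zero_ne : g 0 ≠ 0 := tendsto_nhds_unique (pointwise 0) h₀ ▸ hL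
  obtain ⟨α, β, y, H⟩ := PolySeq.exists_isHadamardForm pointwise g_zero_ne h₁ h₂ hzero
  replace H := H.restrict_ne_zero
  refine ⟨g, hg, hconv, α, β, {j // y j ≠ 0}, inferInstance, fun j => (y j)⁻¹,
    fun j => H.inv_mem j.2, by simpa using H.summable_norm_sq,
    fun z => ⟨(H.hasProd_zeros z).multipliable, ?_⟩, by simpa using H.summable_re,
    by simpa using H.tsum_re_le, H.nonneg⟩
  rw [mul_assoc, ← H.eq_exp_mul_tprod z, mul_div_cancel₀ _ g_zero_ne]

theorem theorem2p5 (f : ℕ → Polynomial ℂ)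
    (hweak : PolySeq.WeaklyConvergent f)
    (h0 : ∃ L : ℂ, L ≠ 0 ∧ Tendsto (fun n => (f n).eval 0) atTop (𝓝 L))
    (hzero : ∀ n, PolySeq.zeroSet (f n) ⊆ PolySeq.rightHalfPlane) :
    ∃ g : ℂ → ℂ, Differentiable ℂ g ∧
      PolySeq.StronglyConvergesTo (fun n z => (f n).eval z) g ∧
      ∃ (α : ℝ) (β : ℂ) (ι : Type) (_ : Countable ι) (a : ι → ℂ),
        (∀ j, a j ∈ PolySeq.rightHalfPlane \ {0}) ∧
        Summable (fun j => (‖a j‖ ^ 2)⁻¹) ∧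
        (∀ z : ℂ, Multipliable (fun j => (1 - z / a j) * Complex.exp (z / a j)) ∧
          g z = g 0 * Complex.exp ((α : ℂ) * z ^ 2 - β * z) *
            ∏' j, (1 - z / a j) * Complex.exp (z / a j)) ∧
        Summable (fun j => ((a j)⁻¹).re) ∧
        ∑' j, ((a j)⁻¹).re ≤ β.re ∧
        0 ≤ α :=
  theorem2p5_general f hweak h0 (.of_forall hzero)
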